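/- Let $\kappa\in(0,1)$ and $\lambda=\sqrt{1-\kappa^2}$, and let $\alpha,\beta\in(0,\pi/2)$ be the acute angles with $\kappa=\cos\alpha$ and $\lambda=\cos\beta$. For a modulus $\mu\in(0,1)$ put $f_\mu(T)=\int_0^T {}_2F_1\big(\tfrac14,\tfrac34;\tfrac12;\mu^2\sin^2t\big)\,dt$ for complex $T$ near $0$, let $\phi_\mu$ be the analytic local inverse of $f_\mu$ at $0$ with $\phi_\mu(0)=0$, and let $\psi_\mu$ be the analytic function near $0$ with $\psi_\mu(0)=0$ and $\sin\psi_\mu=\mu\sin\phi_\mu$. **Theorem.** For each $\mu\in\{\kappa,\lambda\}$ there is a unique meromorphic function $d_\mu$ on $\mathbb C$ with $d_\mu=\cos\psi_\mu$ near $0$, and there is a unique pair of real numbers $K_\mu>0$, $K'_\mu>0$ such that $2K_\mu$ and $2iK'_\mu$ are fundamental periods of $d_\mu$ (that is, the set of periods of $d_\mu$ is $2K_\mu\mathbb Z+2iK'_\mu\mathbb Z$). They satisfy $$K_\kappa=I(\beta),\qquad K'_\kappa=\sqrt2\,I(\alpha),\qquad\text{where}\quad I(\gamma)=\int_0^\gamma\frac{\cos\frac12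 t}{\sqrt{\cos^2t-\cos^2\gamma}}\,dt .$$ Consequently $$K'_\kappa=\sqrt2\,K_\lambda\qquad\text{and}\qquad K'_\lambda=\sqrt2\,K_\kappa .$$ -/

import Mathlib

namespace SignatureFour

/-- The function `f(T) = ∫₀^T F(1/4, 3/4; 1/2; κ² sin² t) dt` with modulus `κ`, for complex `T`
near `0`: the integral is taken along the segment from `0` to `T`, parametrized as `t = s * T`
with `0 ≤ s ≤ 1`. -/
noncomputable def f (κ : ℝ) (T : ℂ) : ℂ :=
  T * ∫ s in (0 : ℝ)..1,
    ₂F₁ (1 / 4 : ℂ) (3 / 4 : ℂ) (1 / 2 : ℂ) ((κ : ℂ) ^ 2 * Complex.sin ((s : ℂ) * T) ^ 2)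

/-- `φ` is (near `0`) the analytic inverse of `f κ` with `φ 0 = 0`. -/
structure IsPhi (κ : ℝ) (φ : ℂ → ℂ) : Prop where
  analyticAt : AnalyticAt ℂ φ 0
  map_zero : φ 0 = 0
  left_inverse : ∀ᶠ T in nhds (0 : ℂ), φ (f κ T) = T
  right_inverse : ∀ᶠ z in nhds (0 : ℂ), f κ (φ z) = z

/-- `ψ` is (near `0`) the analytic function with `ψ 0 = 0` and `sin ψ = κ sin φ`. -/
structure IsPsi (κ : ℝ) (φ ψ : ℂ → ℂ) : Prop where
  analyticAt : AnalyticAt ℂ ψ 0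
  map_zero : ψ 0 = 0
  sin_eq : ∀ᶠ z in nhds (0 : ℂ), Complex.sin (ψ z) = (κ : ℂ) * Complex.sin (φ z)

/-- `d` is the meromorphic function on the whole complex plane that is given near `0` by
`d = cos ψ`. Meromorphic functions are represented by total functions in normal form: removable
singularities are removed, and the value at a pole is `0` by convention. -/
structure IsD (κ : ℝ) (d : ℂ → ℂ) : Prop where
  meromorphic : MeromorphicNFOn d Set.univ
  eq_cos_psi : ∃ φ ψ : ℂ → ℂ, IsPhi κ φ ∧ IsPsi κ φ ψ ∧
    ∀ᶠ z in nhds (0 : ℂ), d z = Complex.cos (ψ z)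

/-- `K > 0` and `K' > 0` are real numbers such that `2 K` and `2 i K'` are fundamental periods
of `d`: the periods of `d` are exactly their integral linear combinations. -/
structure IsHalfPeriods (d : ℂ → ℂ) (K K' : ℝ) : Prop where
  pos : 0 < K
  pos' : 0 < K'
  periodic_iff : ∀ ω : ℂ, Function.Periodic d ω ↔
    ∃ m n : ℤ, ω = (m : ℂ) * (2 * (K : ℂ)) + (n : ℂ) * (2 * Complex.I * (K' : ℂ))

/-- `I(γ) = ∫₀^γ cos (t / 2) / √(cos² t - cos² γ) dt`. -/
noncomputable def I (γ : ℝ) : ℝ :=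
  ∫ t in (0 : ℝ)..γ, Real.cos (t / 2) / √(Real.cos t ^ 2 - Real.cos γ ^ 2)

end SignatureFour

/-!
Since `₂F₁(1/4, 3/4; 1/2; sin² z) = cos (z / 2) / cos z`, the germ `d = cos ψ` of modulus `κ` is the
solution of `d'' = 1 - κ² + 2 d - 3 d²` with `d 0 = 1` and `d' 0 = 0`. A rational map of degree two
carries `v ↦ d_λ (v / (√2 i))` to a solution of the same problem, hence to `d_κ`. So if the germs of
both moduli are meromorphic on a disc of radius `R`, then both are on the disc of radius `√2 R`, and
therefore on `ℂ`.

On the real axis `d_κ` obeys the energy equation `d'² = 2 (1 - d) (d² - λ²)` and decreases from `1`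
to its first critical value `λ = cos β`; substituting `d = cos t` shows that this happens at `I β`.
By uniqueness for the differential equation, `d_κ` is symmetric about a critical point, which gives
the period `2 I β`. The rational map turns the real period `2 I α` of `d_λ` into the imaginary
period `2 √2 i I α` of `d_κ`. Since `d_κ` takes the value `1` neither on `(0, I β]` nor on
`i (0, √2 I α]`, and has a pole at `i √2 I α` but not at `I β`, there are no further periods.
-/

open Filter Topology Complex
open scoped ComplexConjugate

namespace SignatureFour

/-! ### The hypergeometric integral and its inverse -/

theorem ascPochhammer_eval_two_mul {K : Type*} [Field K] [NeZero (2 : K)] (a : K) (n : ℕ) :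
    (ascPochhammer K (2 * n)).eval (2 * a) =
      4 ^ n * (ascPochhammer K n).eval a * (ascPochhammer K n).eval (a + 1 / 2) := by
  induction n with
  | zero => simp
  | succ n ih =>
    rw [show 2 * (n + 1) = 2 * n + 1 + 1 by ring]
    simp only [ascPochhammer_succ_eval, ih]
    push_cast
    field_simp [two_ne_zero (α := K)]
    ring

theorem factorial_two_mul_eq {K : Type*} [Field K] [NeZero (2 : K)] (n : ℕ) :
    ((2 * n).factorial : K) = 4 ^ n * n.factorial * (ascPochhammer K n).eval (1 / 2) := by
  have h := ascPochhammer_eval_two_mul (1 / 2 : K) n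
  rw [mul_one_div_cancel two_ne_zero, add_halves, ascPochhammer_eval_one,
    ascPochhammer_eval_one] at h
  rw [h]
  ring

theorem hasSum_one_sub_cpow_neg (a : ℂ) {x : ℂ} (hx : ‖x‖ < 1) :
    HasSum (fun n : ℕ => (n.factorial : ℂ)⁻¹ * (ascPochhammer ℂ n).eval a * x ^ n)
      ((1 - x) ^ (-a)) := by
  have hone (k : ℕ) : (k : ℂ) ≠ -1 := fun h => k.cast_add_one_ne_zero (R := ℂ) (by simp [h])
  have h := (one_add_cpow_hasFPowerSeriesOnBall_zero (a := -a)).hasSum (y := -x) (by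
    simpa [Metric.mem_eball, edist_zero_right, enorm_eq_nnnorm, ← NNReal.coe_lt_coe] using hx)
  rw [binomialSeries_eq_ordinaryHypergeometricSeries (b := (1 : ℂ)) hone, neg_neg, zero_add,
    ← sub_eq_add_neg] at h
  refine h.congr_fun fun n => ?_
  have hfun : (⇑(-(ContinuousLinearMap.id ℂ ℂ)) : ℂ → ℂ) ∘ (fun _ : Fin n => -x) = fun _ => x := by
    ext; simp
  have hn : (ascPochhammer ℂ n).eval 1 ≠ 0 := by
    rw [ascPochhammer_eval_one]; exact_mod_cast n.factorial_ne_zero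
  rw [FormalMultilinearSeries.compContinuousLinearMap_apply, hfun,
    ordinaryHypergeometricSeries_apply_eq, mul_inv_cancel_right₀ hn, smul_eq_mul]

/-- The two binomial series add up to twice their even part. -/
theorem ordinaryHypergeometric_add_half {x : ℂ} (a : ℂ) (hx : ‖x‖ < 1) :
    ₂F₁ a (a + 1 / 2) (1 / 2 : ℂ) (x ^ 2) =
      ((1 - x) ^ (-(2 * a)) + (1 + x) ^ (-(2 * a))) / 2 := by
  have h := ((hasSum_one_sub_cpow_neg (2 * a) hx).add
    (hasSum_one_sub_cpow_neg (2 * a) (x := -x) (by simpa))).div_const 2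
  rw [sub_neg_eq_add] at h
  have hinj : Function.Injective (fun n : ℕ => 2 * n) := fun _ _ h => by simpa using h
  rw [← hinj.hasSum_iff] at h
  · rw [ordinaryHypergeometric_eq_tsum, ← h.tsum_eq]
    refine tsum_congr fun n => ?_
    simp only [Function.comp, smul_eq_mul, ascPochhammer_eval_two_mul, factorial_two_mul_eq,
      (even_two_mul n).neg_pow, ← pow_mul, mul_inv]
    field_simp
    ring
  · intro n hn
    have hodd : Odd n := by
      rw [← Nat.not_even_iff_odd, even_iff_exists_two_mul]
      exact fun ⟨k, hk⟩ => hn ⟨k, hk.symm⟩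
    rw [hodd.neg_pow]
    ring

theorem sin_eq_two_mul_sin_half_mul_cos_half (z : ℂ) : sin z = 2 * sin (z / 2) * cos (z / 2) := by
  rw [← sin_two_mul, mul_div_cancel₀ z two_ne_zero]

theorem eventually_hypergeometric_sin_sq :
    ∀ᶠ z in 𝓝 (0 : ℂ), ₂F₁ (1 / 4 : ℂ) (3 / 4 : ℂ) (1 / 2 : ℂ) (sin z ^ 2) =
      cos (z / 2) / cos z := by
  have hsin : ∀ᶠ z : ℂ in 𝓝 0, ‖sin z‖ < 1 :=
    ContinuousAt.eventually_lt (by fun_prop) continuousAt_const (by simp)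
  have hadd : ∀ᶠ z : ℂ in 𝓝 0, 0 < (cos (z / 2) + sin (z / 2)).re :=
    ContinuousAt.eventually_lt continuousAt_const (by fun_prop) (by simp)
  have hsub : ∀ᶠ z : ℂ in 𝓝 0, 0 < (cos (z / 2) - sin (z / 2)).re :=
    ContinuousAt.eventually_lt continuousAt_const (by fun_prop) (by simp)
  filter_upwards [hsin, hadd, hsub] with z hz hadd hsub
  have hs := sin_eq_two_mul_sin_half_mul_cos_half z
  have hc : cos z = (cos (z / 2) - sin (z / 2)) * (cos (z / 2) + sin (z / 2)) := by
    rw [mul_comm, ← sq_sub_sq, ← cos_two_mul', mul_div_cancel₀ z two_ne_zero]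
  have hsc := sin_sq_add_cos_sq (z / 2)
  have hsub_sq : 1 - sin z = (cos (z / 2) - sin (z / 2)) ^ 2 := by linear_combination -hs - hsc
  have hadd_sq : 1 + sin z = (cos (z / 2) + sin (z / 2)) ^ 2 := by linear_combination hs - hsc
  have hadd_ne : cos (z / 2) + sin (z / 2) ≠ 0 := fun h => by simp [h] at hadd
  have hsub_ne : cos (z / 2) - sin (z / 2) ≠ 0 := fun h => by simp [h] at hsub
  have h := ordinaryHypergeometric_add_half (1 / 4) hz
  norm_num only at h
  rw [h, hsub_sq, hadd_sq, cpow_neg, cpow_neg, one_div, sq_cpow_two_inv hadd,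
    sq_cpow_two_inv hsub, hc]
  field_simp
  ring

theorem analyticAt_ordinaryHypergeometric {a b c : ℂ}
    (habc : ∀ k : ℕ, (k : ℂ) ≠ -a ∧ (k : ℂ) ≠ -b ∧ (k : ℂ) ≠ -c) :
    AnalyticAt ℂ (₂F₁ a b c : ℂ → ℂ) 0 :=
  ((ordinaryHypergeometricSeries ℂ a b c).hasFPowerSeriesOnBall (by
    rw [ordinaryHypergeometricSeries_radius_eq_one ℂ a b c habc]
    exact zero_lt_one)).analyticAt

theorem eventually_hasDerivAt_segmentIntegral {g : ℂ → ℂ} (hg : AnalyticAt ℂ g 0) :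
    ∀ᶠ T in 𝓝 (0 : ℂ), HasDerivAt (fun T => T * ∫ s in (0 : ℝ)..1, g (s * T)) (g T) T := by
  obtain ⟨r, hr, han⟩ := Metric.eventually_nhds_iff_ball.1 hg.eventually_analyticAt
  have hd : DifferentiableOn ℂ g (Metric.ball 0 r) :=
    fun z hz => (han z hz).differentiableAt.differentiableWithinAt
  obtain ⟨P, hP⟩ := hd.isExactOn_ball
  have heq : ∀ T ∈ Metric.ball (0 : ℂ) r, T * ∫ s in (0 : ℝ)..1, g (s * T) = P T - P 0 := by
    intro T hT
    have hmem : ∀ s ∈ Set.Icc (0 : ℝ) 1, 0 + s • T ∈ Metric.ball (0 : ℂ) r := fun s hs =>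
      (convex_ball 0 r).add_smul_mem (Metric.mem_ball_self hr) (by rwa [zero_add]) hs
    simpa using intervalIntegral.integral_unitInterval_deriv_eq_sub
      (hd.continuousOn.comp (by fun_prop) hmem) fun s hs => hP _ (hmem s hs)
  filter_upwards [Metric.ball_mem_nhds (0 : ℂ) hr] with T hT
  refine ((hP T hT).sub_const (P 0)).congr_of_eventuallyEq ?_
  filter_upwards [Metric.isOpen_ball.mem_nhds hT] with z hz using heq z hz

theorem eventually_hasDerivAt_f (κ : ℝ) : ∀ᶠ T in 𝓝 (0 : ℂ),
    HasDerivAt (f κ) (₂F₁ (1 / 4 : ℂ) (3 / 4 : ℂ) (1 / 2 : ℂ) ((κ : ℂ) ^ 2 * sin T ^ 2)) T := by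
  have hF : AnalyticAt ℂ (₂F₁ (1 / 4 : ℂ) (3 / 4 : ℂ) (1 / 2 : ℂ) : ℂ → ℂ) 0 := by
    refine analyticAt_ordinaryHypergeometric fun k => ?_
    refine ⟨?_, ?_, ?_⟩ <;> intro h <;> have := congrArg re h <;> norm_num at this <;>
      linarith [k.cast_nonneg (α := ℝ)]
  refine eventually_hasDerivAt_segmentIntegral
    (g := fun t => ₂F₁ (1 / 4 : ℂ) (3 / 4 : ℂ) (1 / 2 : ℂ) ((κ : ℂ) ^ 2 * sin t ^ 2)) ?_
  exact AnalyticAt.fun_comp (f := fun t : ℂ => (κ : ℂ) ^ 2 * sin t ^ 2) (by simpa using hF)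
    (by fun_prop)

theorem exists_isPhi (κ : ℝ) : ∃ φ, IsPhi κ φ := by
  have hf0 : f κ 0 = 0 := by simp [f]
  have ha : AnalyticAt ℂ (f κ) 0 := Complex.analyticAt_iff_eventually_differentiableAt.2
    ((eventually_hasDerivAt_f κ).mono fun _ h => h.differentiableAt)
  have hd : deriv (f κ) 0 ≠ 0 := by
    rw [(eventually_hasDerivAt_f κ).self_of_nhds.deriv]
    simp
  have hstrict := ha.hasStrictDerivAt
  have hequiv := hstrict.hasStrictFDerivAt_equiv hd
  refine ⟨hstrict.localInverse _ _ _ hd, ?_, ?_, hequiv.eventually_left_inverse, ?_⟩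
  · simpa only [hf0] using ha.analyticAt_localInverse hd
  · simpa only [hf0] using hequiv.localInverse_apply_image
  · simpa only [hf0] using hequiv.eventually_right_inverse

theorem IsPhi.exists_isPsi {κ : ℝ} {φ : ℂ → ℂ} (hφ : IsPhi κ φ) : ∃ ψ, IsPsi κ φ ψ := by
  have ha : AnalyticAt ℂ sin 0 := by fun_prop
  have hd : deriv sin (0 : ℂ) ≠ 0 := by simp
  have hstrict := ha.hasStrictDerivAt
  have hequiv := hstrict.hasStrictFDerivAt_equiv hd
  have hφa := hφ.analyticAt
  have hg : AnalyticAt ℂ (fun z => (κ : ℂ) * sin (φ z)) 0 := by fun_prop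
  have hg0 : (κ : ℂ) * sin (φ 0) = sin 0 := by simp [hφ.map_zero]
  refine ⟨fun z => hstrict.localInverse _ _ _ hd (κ * sin (φ z)), ?_, ?_, ?_⟩
  · refine AnalyticAt.fun_comp (f := fun z => (κ : ℂ) * sin (φ z)) ?_ hg
    simpa only [hg0] using ha.analyticAt_localInverse hd
  · simpa only [hg0] using hequiv.localInverse_apply_image
  · have hlim := hg.continuousAt.tendsto
    simp only [hg0] at hlim
    exact hlim.eventually hequiv.eventually_right_inverse

theorem IsPhi.eventually_hasDerivAt {κ : ℝ} {φ ψ : ℂ → ℂ} (hφ : IsPhi κ φ) (hψ : IsPsi κ φ ψ) :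
    ∀ᶠ z in 𝓝 (0 : ℂ), cos (ψ z / 2) ≠ 0 ∧ HasDerivAt φ (cos (ψ z) / cos (ψ z / 2)) z ∧
      HasDerivAt ψ (κ * cos (φ z) / cos (ψ z / 2)) z := by
  have hφ0 : Tendsto φ (𝓝 0) (𝓝 0) := by
    simpa only [hφ.map_zero] using hφ.analyticAt.continuousAt.tendsto
  have hψ0 : Tendsto ψ (𝓝 0) (𝓝 0) := by
    simpa only [hψ.map_zero] using hψ.analyticAt.continuousAt.tendsto
  have hcos : ∀ᶠ z in 𝓝 (0 : ℂ), cos z ≠ 0 := continuous_cos.continuousAt.eventually_ne (by simp)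
  have hcos_half : ∀ᶠ z in 𝓝 (0 : ℂ), cos (z / 2) ≠ 0 :=
    ContinuousAt.eventually_ne (g := fun z : ℂ => cos (z / 2)) (by fun_prop) (by simp)
  filter_upwards [hψ0.eventually hcos, hψ0.eventually hcos_half,
    hψ0.eventually eventually_hypergeometric_sin_sq, hφ0.eventually (eventually_hasDerivAt_f κ),
    hφ.right_inverse.eventually_nhds, hφ.analyticAt.eventually_analyticAt,
    hψ.analyticAt.eventually_analyticAt, hψ.sin_eq.eventually_nhds]
    with z hc hch hF hf hinv hφa hψa hsin
  rw [← mul_pow, ← hsin.self_of_nhds, hF] at hf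
  have hφ' : HasDerivAt φ (cos (ψ z) / cos (ψ z / 2)) z := by
    have hmul := (hf.comp z hφa.differentiableAt.hasDerivAt).unique
      ((hasDerivAt_id z).congr_of_eventuallyEq hinv)
    refine hφa.differentiableAt.hasDerivAt.congr_deriv ?_
    field_simp at hmul ⊢
    linear_combination hmul
  refine ⟨hch, hφ', hψa.differentiableAt.hasDerivAt.congr_deriv ?_⟩
  have hmul := hψa.differentiableAt.hasDerivAt.csin.unique
    ((hφ'.csin.const_mul (κ : ℂ)).congr_of_eventuallyEq hsin)
  field_simp at hmul ⊢
  exact hmul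

/-- The germs at `0` of the functions `d` of modulus `κ`, characterized by the differential
equation that replaces the hypergeometric function in the rest of the argument. -/
structure IsGerm (κ : ℝ) (d : ℂ → ℂ) : Prop where
  analyticAt : AnalyticAt ℂ d 0
  map_zero : d 0 = 1
  deriv_zero : deriv d 0 = 0
  ode : ∀ᶠ z in 𝓝 (0 : ℂ), deriv (deriv d) z = 1 - (κ : ℂ) ^ 2 + 2 * d z - 3 * d z ^ 2

theorem IsGerm.congr {κ : ℝ} {d e : ℂ → ℂ} (hd : IsGerm κ d) (h : e =ᶠ[𝓝 0] d) : IsGerm κ e where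
  analyticAt := hd.analyticAt.congr h.symm
  map_zero := h.self_of_nhds.trans hd.map_zero
  deriv_zero := h.deriv_eq.trans hd.deriv_zero
  ode := by
    filter_upwards [hd.ode, h, h.deriv.deriv] with z hz h0 h2
    rw [h2, h0, hz]

theorem IsPsi.deriv_cos_comp {κ : ℝ} {φ ψ : ℂ → ℂ} (hψ : IsPsi κ φ ψ) (hφ : IsPhi κ φ) :
    deriv (fun z => cos (ψ z)) =ᶠ[𝓝 0] fun z => -(2 * κ) * (sin (ψ z / 2) * cos (φ z)) := by
  filter_upwards [hφ.eventually_hasDerivAt hψ] with z ⟨hne, _, hψ'⟩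
  rw [hψ'.ccos.deriv, sin_eq_two_mul_sin_half_mul_cos_half]
  field_simp

theorem IsPsi.isGerm {κ : ℝ} {φ ψ : ℂ → ℂ} (hψ : IsPsi κ φ ψ) (hφ : IsPhi κ φ) :
    IsGerm κ (fun z => cos (ψ z)) := by
  have hderiv := hψ.deriv_cos_comp hφ
  have hψa := hψ.analyticAt
  refine ⟨by fun_prop, by simp [hψ.map_zero], by simp [hderiv.self_of_nhds, hψ.map_zero], ?_⟩
  filter_upwards [hderiv.deriv, hφ.eventually_hasDerivAt hψ, hψ.sin_eq] with z hz ⟨hne, hφ', hψ'⟩ hs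
  have hsin := sin_eq_two_mul_sin_half_mul_cos_half (ψ z)
  have hcos : cos (ψ z) = 1 - 2 * sin (ψ z / 2) ^ 2 := by
    rw [← cos_two_mul_eq_one_sub, mul_div_cancel₀ _ two_ne_zero]
  have hcosφ : (κ * cos (φ z)) ^ 2 = κ ^ 2 - (2 * sin (ψ z / 2) * cos (ψ z / 2)) ^ 2 := by
    rw [← hsin, hs]
    linear_combination (κ : ℂ) ^ 2 * sin_sq_add_cos_sq (φ z)
  calc deriv (deriv fun z => cos (ψ z)) z
    _ = -(κ * cos (φ z)) ^ 2 +
        2 * sin (ψ z / 2) * (κ * sin (φ z)) * cos (ψ z) / cos (ψ z / 2) := by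
      rw [hz, (((hψ'.div_const 2).csin.fun_mul hφ'.ccos).const_mul _).deriv]
      field_simp
      ring
    _ = -(κ * cos (φ z)) ^ 2 + 4 * sin (ψ z / 2) ^ 2 * cos (ψ z) := by
      rw [← hs, hsin]
      field_simp
      ring
    _ = 1 - (κ : ℂ) ^ 2 + 2 * cos (ψ z) - 3 * cos (ψ z) ^ 2 := by
      rw [hcosφ, hcos, mul_pow, cos_sq']
      ring

/-! ### The differential equation -/

theorem eventuallyEq_of_deriv_eq {E : Type*} [NormedAddCommGroup E] [NormedSpace ℂ E]
    [CompleteSpace E] {f g : ℂ → E} {v : E → E} {x : ℂ} (hf : AnalyticAt ℂ f x)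
    (hg : AnalyticAt ℂ g x) (hv : ContDiffAt ℂ 1 v (f x)) (h0 : f x = g x)
    (hf' : ∀ᶠ z in 𝓝 x, deriv f z = v (f z))
    (hg' : ∀ᶠ z in 𝓝 x, deriv g z = v (g z)) : f =ᶠ[𝓝 x] g := by
  obtain ⟨K, s, hs, hLip⟩ := hv.exists_lipschitzOnWith
  have hline : Tendsto (fun t : ℝ => x + t) (𝓝 0) (𝓝 x) :=
    Continuous.tendsto' (by fun_prop) _ _ (by simp)
  have hsol {h : ℂ → E} (hh : AnalyticAt ℂ h x) (hx : s ∈ 𝓝 (h x))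
      (hh' : ∀ᶠ z in 𝓝 x, deriv h z = v (h z)) : ∀ᶠ t : ℝ in 𝓝 0,
        HasDerivAt (fun t : ℝ => h (x + t)) (v (h (x + t))) t ∧ h (x + t) ∈ s := by
    filter_upwards [hline.eventually hh.eventually_analyticAt, hline.eventually hh',
      hline.eventually (hh.continuousAt.eventually_mem hx)] with t ht ht' hts
    refine ⟨?_, hts⟩
    simpa [ht', Function.comp_def] using ht.differentiableAt.hasDerivAt.scomp t
      ((hasDerivAt_id t).ofReal_comp.const_add x)
  have heq : ∀ᶠ t : ℝ in 𝓝 0, f (x + t) = g (x + t) :=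
    ODE_solution_unique_of_eventually (v := fun _ => v) (s := fun _ => s)
      (Eventually.of_forall fun _ => hLip) (hsol hf hs hf') (hsol hg (h0 ▸ hs) hg') (by simpa)
  have hline_ne : Tendsto (fun t : ℝ => x + t) (𝓝[≠] 0) (𝓝[≠] x) :=
    hline.inf (tendsto_principal_principal.2 fun t ht => by simpa using ht)
  exact (hf.frequently_eq_iff_eventually_eq hg).1
    (hline_ne.frequently (heq.filter_mono nhdsWithin_le_nhds).frequently)

theorem eventuallyEq_of_deriv_deriv_eq {f g P : ℂ → ℂ} {x : ℂ} (hf : AnalyticAt ℂ f x)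
    (hg : AnalyticAt ℂ g x) (hP : AnalyticAt ℂ P (f x)) (h0 : f x = g x)
    (h1 : deriv f x = deriv g x) (hf' : ∀ᶠ z in 𝓝 x, deriv (deriv f) z = P (f z))
    (hg' : ∀ᶠ z in 𝓝 x, deriv (deriv g) z = P (g z)) : f =ᶠ[𝓝 x] g := by
  have hv : ContDiffAt ℂ 1 (fun p : ℂ × ℂ => (p.2, P p.1)) (f x, deriv f x) :=
    contDiffAt_snd.prodMk (ContDiffAt.comp (g := P) _ hP.contDiffAt contDiffAt_fst)
  have hsol {h : ℂ → ℂ} (hh : AnalyticAt ℂ h x)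
      (hh' : ∀ᶠ z in 𝓝 x, deriv (deriv h) z = P (h z)) :
      ∀ᶠ z in 𝓝 x, deriv (fun z => (h z, deriv h z)) z = (deriv h z, P (h z)) := by
    filter_upwards [hh.eventually_analyticAt, hh.deriv.eventually_analyticAt, hh'] with z hz hz' h'
    rw [(hz.differentiableAt.hasDerivAt.prodMk hz'.differentiableAt.hasDerivAt).deriv, h']
  have hpair := eventuallyEq_of_deriv_eq (f := fun z => (f z, deriv f z))
    (g := fun z => (g z, deriv g z)) (hf.prod hf.deriv) (hg.prod hg.deriv) hv (by rw [h0, h1])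
    (hsol hf hf') (hsol hg hg')
  exact hpair.mono fun z hz => congrArg Prod.fst hz

theorem IsGerm.unique {κ : ℝ} {d e : ℂ → ℂ} (hd : IsGerm κ d) (he : IsGerm κ e) : d =ᶠ[𝓝 0] e :=
  eventuallyEq_of_deriv_deriv_eq (P := fun w => 1 - (κ : ℂ) ^ 2 + 2 * w - 3 * w ^ 2)
    hd.analyticAt he.analyticAt (by fun_prop) (hd.map_zero.trans he.map_zero.symm)
    (hd.deriv_zero.trans he.deriv_zero.symm) hd.ode he.ode

theorem IsGerm.energy {κ : ℝ} {d : ℂ → ℂ} (hd : IsGerm κ d) :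
    ∀ᶠ z in 𝓝 (0 : ℂ), deriv d z ^ 2 = 2 * (1 - d z) * (d z ^ 2 - (1 - (κ : ℂ) ^ 2)) := by
  have ha := hd.analyticAt
  have ha' := ha.deriv
  have hconst := eventuallyEq_of_deriv_eq (x := 0) (v := 0) (g := fun _ => 0)
    (f := fun z => deriv d z ^ 2 - 2 * (1 - d z) * (d z ^ 2 - (1 - (κ : ℂ) ^ 2)))
    (by fun_prop) (by fun_prop) contDiffAt_const (by simp [hd.map_zero, hd.deriv_zero]) (by
      filter_upwards [ha.eventually_analyticAt, ha'.eventually_analyticAt, hd.ode]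
        with z hz hz' hode
      have hd1 := hz.differentiableAt.hasDerivAt
      have hd2 := hz'.differentiableAt.hasDerivAt
      rw [((hd2.fun_pow 2).fun_sub (((hd1.const_sub 1).const_mul 2).fun_mul
        ((hd1.fun_pow 2).sub_const _))).deriv, hode]
      simp only [Pi.zero_apply]
      push_cast
      ring) (by simp)
  exact hconst.mono fun z hz => sub_eq_zero.1 hz

theorem exists_isGerm (κ : ℝ) : ∃ d, IsGerm κ d := by
  obtain ⟨φ, hφ⟩ := exists_isPhi κ
  obtain ⟨ψ, hψ⟩ := hφ.exists_isPsi
  exact ⟨_, hψ.isGerm hφ⟩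

theorem isD_iff {κ : ℝ} {d : ℂ → ℂ} : IsD κ d ↔ MeromorphicNFOn d Set.univ ∧ IsGerm κ d := by
  refine ⟨fun ⟨hm, φ, ψ, hφ, hψ, hd⟩ => ⟨hm, (hψ.isGerm hφ).congr hd⟩, fun ⟨hm, hd⟩ => ⟨hm, ?_⟩⟩
  obtain ⟨φ, hφ⟩ := exists_isPhi κ
  obtain ⟨ψ, hψ⟩ := hφ.exists_isPsi
  exact ⟨φ, ψ, hφ, hψ, hd.unique (hψ.isGerm hφ)⟩

/-! ### Meromorphic continuation -/

section Meromorphic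

variable {𝕜 E : Type*} [NontriviallyNormedField 𝕜] [NormedAddCommGroup E] [NormedSpace 𝕜 E]
  {f g : 𝕜 → E} {U : Set 𝕜} {x y : 𝕜}

theorem eventuallyEq_nhdsNE_of_meromorphicOn (hf : MeromorphicOn f U) (hg : MeromorphicOn g U)
    (hU : IsPreconnected U) (hx : x ∈ U) (hy : y ∈ U) (h : f =ᶠ[𝓝[≠] x] g) :
    f =ᶠ[𝓝[≠] y] g := by
  rw [eventuallyEq_iff_sub] at h ⊢
  by_contra hne
  exact (hf.sub hg).meromorphicOrderAt_ne_top_of_isPreconnected hU hy hx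
    (mt meromorphicOrderAt_eq_top_iff.1 hne) (meromorphicOrderAt_eq_top_iff.2 h)

theorem eqOn_of_meromorphicNFOn (hf : MeromorphicNFOn f U) (hg : MeromorphicNFOn g U)
    (hU : IsPreconnected U) (hx : x ∈ U) (h : f =ᶠ[𝓝[≠] x] g) : Set.EqOn f g U := fun _ hy =>
  (((hf hy).eventuallyEq_nhdsNE_iff_eventuallyEq_nhds (hg hy)).1
    (eventuallyEq_nhdsNE_of_meromorphicOn hf.meromorphicOn hg.meromorphicOn hU hx hy h)).eq_of_nhds

theorem toMeromorphicNFOn_eventuallyEq_nhds (hf : MeromorphicOn f U) (hx : x ∈ U)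
    (ha : AnalyticAt 𝕜 f x) : toMeromorphicNFOn f U =ᶠ[𝓝 x] f :=
  ((meromorphicNFOn_toMeromorphicNFOn f U hx).eventuallyEq_nhdsNE_iff_eventuallyEq_nhds
    ha.meromorphicNFAt).1 (hf.toMeromorphicNFOn_eq_self_on_nhdsNE hx)

theorem eventuallyEq_nhds_of_meromorphicOn (hf : MeromorphicOn f U) (hg : MeromorphicOn g U)
    (hU : IsPreconnected U) (hx : x ∈ U) (hy : y ∈ U) (hfy : AnalyticAt 𝕜 f y)
    (hgy : AnalyticAt 𝕜 g y) (h : f =ᶠ[𝓝[≠] x] g) : f =ᶠ[𝓝 y] g :=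
  (hfy.meromorphicNFAt.eventuallyEq_nhdsNE_iff_eventuallyEq_nhds hgy.meromorphicNFAt).1
    (eventuallyEq_nhdsNE_of_meromorphicOn hf hg hU hx hy h)

theorem eq_of_meromorphicNFOn_univ [PreconnectedSpace 𝕜] (hf : MeromorphicNFOn f Set.univ)
    (hg : MeromorphicNFOn g Set.univ) (h : f =ᶠ[𝓝[≠] x] g) : f = g :=
  funext fun z => eqOn_of_meromorphicNFOn hf hg isPreconnected_univ (Set.mem_univ x) h
    (Set.mem_univ z)

theorem exists_meromorphicNFOn_univ {f : ℂ → E} [NormedSpace ℂ E] (hf : AnalyticAt ℂ f 0)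
    (h : ∀ R, ∃ g : ℂ → E, MeromorphicOn g (Metric.ball 0 R) ∧ g =ᶠ[𝓝 0] f) :
    ∃ G : ℂ → E, MeromorphicNFOn G Set.univ ∧ G =ᶠ[𝓝 0] f := by
  have hNF (R : ℝ) (hR : 0 < R) :
      ∃ g : ℂ → E, MeromorphicNFOn g (Metric.ball 0 R) ∧ g =ᶠ[𝓝 0] f := by
    obtain ⟨g, hg, hgf⟩ := h R
    exact ⟨_, meromorphicNFOn_toMeromorphicNFOn g _, (toMeromorphicNFOn_eventuallyEq_nhds hg
      (Metric.mem_ball_self hR) (hf.congr hgf.symm)).trans hgf⟩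
  choose g hg hgf using hNF
  have hpos (z : ℂ) : 0 < ‖z‖ + 1 := by positivity
  have hmem (z : ℂ) : z ∈ Metric.ball 0 (‖z‖ + 1) := by simp
  have hcompat {R S : ℝ} (hR : 0 < R) (hS : 0 < S) (hRS : R ≤ S) :
      Set.EqOn (g R hR) (g S hS) (Metric.ball 0 R) :=
    eqOn_of_meromorphicNFOn (hg R hR) (fun z hz => hg S hS (Metric.ball_subset_ball hRS hz))
      (convex_ball 0 R).isPreconnected (Metric.mem_ball_self hR)
      (((hgf R hR).trans (hgf S hS).symm).filter_mono nhdsWithin_le_nhds)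
  have hlocal (z : ℂ) : (fun w => g (‖w‖ + 1) (hpos w) w) =ᶠ[𝓝 z] g (‖z‖ + 1) (hpos z) := by
    filter_upwards [Metric.isOpen_ball.mem_nhds (hmem z)] with w hw
    rcases le_total (‖w‖ + 1) (‖z‖ + 1) with hwz | hzw
    · exact hcompat _ _ hwz (hmem w)
    · exact (hcompat _ _ hzw hw).symm
  exact ⟨fun w => g (‖w‖ + 1) (hpos w) w,
    fun z _ => (meromorphicNFAt_congr (hlocal z)).2 (hg _ _ (hmem z)), (hlocal 0).trans (hgf _ _)⟩

end Meromorphic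

/-- The rational function of degree two through which the functions `d` of the complementary
moduli `κ` and `λ` are related: if `2 * c ^ 2 = -1`, then `d_κ v = isogeny κ (d_λ (c * v))`. -/
noncomputable def isogeny (κ w : ℂ) : ℂ :=
  1 + 2 * κ ^ 2 * (1 - w) / (w ^ 2 - κ ^ 2)

theorem hasDerivAt_isogeny {κ w : ℂ} (hw : w ^ 2 - κ ^ 2 ≠ 0) :
    HasDerivAt (isogeny κ) (2 * κ ^ 2 * (w ^ 2 - 2 * w + κ ^ 2) / (w ^ 2 - κ ^ 2) ^ 2) w := by
  have hnum := ((hasDerivAt_id w).const_sub 1).const_mul (2 * κ ^ 2)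
  have hden := ((hasDerivAt_id w).fun_pow 2).sub_const (κ ^ 2)
  refine ((hnum.fun_div hden hw).const_add 1).congr_deriv ?_
  simp only [id_eq]
  push_cast
  ring

theorem meromorphicAt_isogeny_comp (κ : ℂ) {f : ℂ → ℂ} {z : ℂ} (hf : MeromorphicAt f z) :
    MeromorphicAt (fun z => isogeny κ (f z)) z :=
  (MeromorphicAt.const 1 z).fun_add (((MeromorphicAt.const (2 * κ ^ 2) z).fun_mul
    ((MeromorphicAt.const 1 z).fun_sub hf)).fun_div
      ((hf.fun_pow 2).fun_sub (MeromorphicAt.const (κ ^ 2) z)))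

theorem IsGerm.eventually_sq_sub_sq_ne_zero {κ lam : ℝ} (h : κ ^ 2 + lam ^ 2 = 1) (hlam : lam ≠ 0)
    {e : ℂ → ℂ} (he : IsGerm lam e) : ∀ᶠ z in 𝓝 0, e z ^ 2 - (κ : ℂ) ^ 2 ≠ 0 := by
  have hcont := he.analyticAt.continuousAt
  refine ContinuousAt.eventually_ne (g := fun z => e z ^ 2 - (κ : ℂ) ^ 2) (by fun_prop) ?_
  rw [he.map_zero, one_pow, ← ofReal_one, ← h]
  simpa using hlam

theorem IsGerm.deriv_isogeny_comp {κ lam : ℝ} (h : κ ^ 2 + lam ^ 2 = 1) (hlam : lam ≠ 0)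
    {e : ℂ → ℂ} (he : IsGerm lam e) : deriv (fun z => isogeny κ (e z)) =ᶠ[𝓝 0] fun z =>
      2 * κ ^ 2 * (e z ^ 2 - 2 * e z + κ ^ 2) / (e z ^ 2 - κ ^ 2) ^ 2 * deriv e z := by
  filter_upwards [he.analyticAt.eventually_analyticAt, he.eventually_sq_sub_sq_ne_zero h hlam]
    with z hz hne
  exact ((hasDerivAt_isogeny hne).comp z hz.differentiableAt.hasDerivAt).deriv

theorem IsGerm.deriv_deriv_isogeny_comp {κ lam : ℝ} (h : κ ^ 2 + lam ^ 2 = 1) (hlam : lam ≠ 0)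
    {e : ℂ → ℂ} (he : IsGerm lam e) : ∀ᶠ z in 𝓝 0, deriv (deriv fun z => isogeny κ (e z)) z =
      -2 * (1 - κ ^ 2 + 2 * isogeny κ (e z) - 3 * isogeny κ (e z) ^ 2) := by
  have hlam2 : (lam : ℂ) ^ 2 = 1 - κ ^ 2 := by
    rw [eq_sub_iff_add_eq']
    exact_mod_cast h
  filter_upwards [(he.deriv_isogeny_comp h hlam).deriv, he.analyticAt.eventually_analyticAt,
    he.analyticAt.deriv.eventually_analyticAt, he.eventually_sq_sub_sq_ne_zero h hlam, he.ode,
    he.energy] with z hz hea hea' hne hode henergy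
  have he1 := hea.differentiableAt.hasDerivAt
  have he2 := hea'.differentiableAt.hasDerivAt
  have hnum := (((he1.fun_pow 2).fun_sub (he1.const_mul 2)).add_const ((κ : ℂ) ^ 2)).const_mul
    (2 * (κ : ℂ) ^ 2)
  have hden := ((he1.fun_pow 2).sub_const ((κ : ℂ) ^ 2)).fun_pow 2
  rw [hz, ((hnum.fun_div hden (pow_ne_zero 2 hne)).fun_mul he2).deriv, hode, isogeny, hlam2]
  rw [hlam2] at henergy
  field_simp
  push_cast
  rw [henergy]
  ring

theorem IsGerm.isogeny_comp_mul {κ lam : ℝ} (h : κ ^ 2 + lam ^ 2 = 1) (hlam : lam ≠ 0) {c : ℂ}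
    (hc : 2 * c ^ 2 = -1) {e : ℂ → ℂ} (he : IsGerm lam e) :
    IsGerm κ (fun v => isogeny κ (e (c * v))) := by
  have hmul : Tendsto (fun v => c * v) (𝓝 0) (𝓝 0) :=
    Continuous.tendsto' (by fun_prop) _ _ (by simp)
  have hderiv (F : ℂ → ℂ) : deriv (fun v => F (c * v)) = fun v => c * deriv F (c * v) :=
    funext fun v => deriv_comp_mul_left c F v
  have hF : AnalyticAt ℂ (fun z => isogeny κ (e z)) 0 := by
    have hea := he.analyticAt
    exact analyticAt_const.fun_add (AnalyticAt.fun_div (by fun_prop) (by fun_prop)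
      (he.eventually_sq_sub_sq_ne_zero h hlam).self_of_nhds)
  refine ⟨?_, ?_, ?_, ?_⟩
  · exact AnalyticAt.fun_comp (g := fun z => isogeny κ (e z)) (by simpa using hF) (by fun_prop)
  · simp [he.map_zero, isogeny]
  · rw [hderiv fun z => isogeny κ (e z)]
    simp [(he.deriv_isogeny_comp h hlam).self_of_nhds, he.deriv_zero]
  filter_upwards [hmul.eventually (he.deriv_deriv_isogeny_comp h hlam)] with v hv
  rw [hderiv fun z => isogeny κ (e z), deriv_const_mul_field, hderiv]
  beta_reduce
  rw [hv]
  linear_combination (-(1 - κ ^ 2 + 2 * isogeny κ (e (c * v)) - 3 * isogeny κ (e (c * v)) ^ 2)) * hc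

theorem two_mul_inv_sqrt_two_mul_I_sq : 2 * ((√2 * Complex.I : ℂ)⁻¹) ^ 2 = -1 := by
  have hsq : ((√2 : ℝ) : ℂ) ^ 2 = 2 := by exact_mod_cast Real.sq_sqrt zero_le_two
  rw [inv_pow, mul_pow, hsq, I_sq]
  norm_num

theorem IsGerm.exists_meromorphicOn_ball_sqrt_two_mul {κ lam R : ℝ}
    (h : κ ^ 2 + lam ^ 2 = 1) (hlam : lam ≠ 0) {e : ℂ → ℂ} (he : IsGerm lam e)
    (hR : MeromorphicOn e (Metric.ball 0 R)) :
    ∃ d, IsGerm κ d ∧ MeromorphicOn d (Metric.ball 0 (√2 * R)) := by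
  refine ⟨_, he.isogeny_comp_mul h hlam two_mul_inv_sqrt_two_mul_I_sq, fun v hv => ?_⟩
  have hmem : (√2 * Complex.I : ℂ)⁻¹ * v ∈ Metric.ball (0 : ℂ) R := by
    rw [mem_ball_zero_iff] at hv ⊢
    rwa [norm_mul, norm_inv, norm_mul, norm_I, mul_one, norm_real,
      Real.norm_of_nonneg (Real.sqrt_nonneg 2), inv_mul_lt_iff₀ (by positivity)]
  exact meromorphicAt_isogeny_comp κ ((hR _ hmem).comp_analyticAt (by fun_prop))

theorem exists_isGerm_meromorphicOn_ball {κ lam : ℝ} (h : κ ^ 2 + lam ^ 2 = 1) (hκ : κ ≠ 0)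
    (hlam : lam ≠ 0) (R : ℝ) : ∃ d, IsGerm κ d ∧ MeromorphicOn d (Metric.ball 0 R) := by
  have hsmall (μ : ℝ) : ∃ r > 0, ∃ d, IsGerm μ d ∧ MeromorphicOn d (Metric.ball 0 r) := by
    obtain ⟨d, hd⟩ := exists_isGerm μ
    obtain ⟨r, hr, han⟩ := Metric.eventually_nhds_iff_ball.1 hd.analyticAt.eventually_analyticAt
    exact ⟨r, hr, d, hd, fun z hz => (han z hz).meromorphicAt⟩
  obtain ⟨r₁, hr₁, d₁, hd₁, hm₁⟩ := hsmall κ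
  obtain ⟨r₂, hr₂, d₂, hd₂, hm₂⟩ := hsmall lam
  have hr : 0 < min r₁ r₂ := lt_min hr₁ hr₂
  have hpow (n : ℕ) :
      (∃ d, IsGerm κ d ∧ MeromorphicOn d (Metric.ball 0 (√2 ^ n * min r₁ r₂))) ∧
      ∃ d, IsGerm lam d ∧ MeromorphicOn d (Metric.ball 0 (√2 ^ n * min r₁ r₂)) := by
    induction n with
    | zero =>
      exact ⟨⟨d₁, hd₁, hm₁.mono_set (Metric.ball_subset_ball (by simp))⟩,
        ⟨d₂, hd₂, hm₂.mono_set (Metric.ball_subset_ball (by simp))⟩⟩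
    | succ n ih =>
      obtain ⟨⟨d, hd, hdm⟩, e, he, hem⟩ := ih
      rw [pow_succ', mul_assoc]
      exact ⟨he.exists_meromorphicOn_ball_sqrt_two_mul h hlam hem,
        hd.exists_meromorphicOn_ball_sqrt_two_mul (by rwa [add_comm]) hκ hdm⟩
  obtain ⟨n, hn⟩ := pow_unbounded_of_one_lt (R / min r₁ r₂) Real.one_lt_sqrt_two
  obtain ⟨d, hd, hm⟩ := (hpow n).1
  exact ⟨d, hd, hm.mono_set (Metric.ball_subset_ball ((div_lt_iff₀ hr).1 hn).le)⟩

theorem IsD.isGerm {κ : ℝ} {d : ℂ → ℂ} (hd : IsD κ d) : IsGerm κ d := (isD_iff.1 hd).2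

theorem IsD.unique {κ : ℝ} {d e : ℂ → ℂ} (hd : IsD κ d) (he : IsD κ e) : d = e :=
  eq_of_meromorphicNFOn_univ hd.meromorphic he.meromorphic
    ((hd.isGerm.unique he.isGerm).filter_mono nhdsWithin_le_nhds)

theorem existsUnique_isD {κ lam : ℝ} (h : κ ^ 2 + lam ^ 2 = 1) (hκ : κ ≠ 0) (hlam : lam ≠ 0) :
    ∃! d, IsD κ d := by
  obtain ⟨d, hd⟩ := exists_isGerm κ
  obtain ⟨D, hD, hDd⟩ := exists_meromorphicNFOn_univ hd.analyticAt fun R => by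
    obtain ⟨e, he, hem⟩ := exists_isGerm_meromorphicOn_ball h hκ hlam R
    exact ⟨e, hem, he.unique hd⟩
  exact ⟨D, isD_iff.2 ⟨hD, hd.congr hDd⟩, fun e he => he.unique (isD_iff.2 ⟨hD, hd.congr hDd⟩)⟩

/-! ### The real axis -/

theorem analyticAt_conj_comp_conj {f : ℂ → ℂ} {z : ℂ} (hf : AnalyticAt ℂ f (conj z)) :
    AnalyticAt ℂ (fun w => conj (f (conj w))) z := by
  rw [analyticAt_iff_eventually_differentiableAt] at hf ⊢
  filter_upwards [(continuous_conj.tendsto z).eventually hf] with w hw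
  simpa [Function.comp_def] using hw.conj_conj

theorem meromorphicNFAt_conj_comp_conj {f : ℂ → ℂ} {z : ℂ} (hf : MeromorphicNFAt f (conj z)) :
    MeromorphicNFAt (fun w => conj (f (conj w))) z := by
  have hconj := continuous_conj.tendsto z
  rcases hf with h | ⟨n, g, hg, hgz, h⟩
  · left
    filter_upwards [hconj.eventually h] with w hw
    simp [hw]
  · refine Or.inr ⟨n, fun w => conj (g (conj w)), analyticAt_conj_comp_conj hg, by simpa using hgz,
      ?_⟩
    filter_upwards [hconj.eventually h] with w hw
    simp [hw]

theorem deriv_conj_comp_conj (f : ℂ → ℂ) :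
    deriv (fun z => conj (f (conj z))) = fun z => conj (deriv f (conj z)) :=
  funext fun z => by simpa [Function.comp_def] using congrFun (deriv_conj_conj (f := f)) z

section Symmetry

variable {κ : ℝ} {d : ℂ → ℂ}

theorem IsGerm.conj_comp_conj (hd : IsGerm κ d) : IsGerm κ (fun z => conj (d (conj z))) where
  analyticAt := analyticAt_conj_comp_conj (by simpa using hd.analyticAt)
  map_zero := by simp [hd.map_zero]
  deriv_zero := by simp [deriv_conj_comp_conj, hd.deriv_zero]
  ode := by
    filter_upwards [(continuous_conj.tendsto' 0 0 (by simp)).eventually hd.ode] with z hz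
    simp [deriv_conj_comp_conj, hz, conj_ofNat]

theorem IsGerm.comp_neg (hd : IsGerm κ d) : IsGerm κ (fun z => d (-z)) := by
  have hderiv (g : ℂ → ℂ) : deriv (fun z => g (-z)) = fun z => -deriv g (-z) :=
    funext fun z => deriv_comp_neg g z
  refine ⟨AnalyticAt.fun_comp (g := d) (by simpa using hd.analyticAt) (by fun_prop),
    by simp [hd.map_zero], by simp [hderiv, hd.deriv_zero], ?_⟩
  filter_upwards [(continuous_neg.tendsto' (0 : ℂ) 0 neg_zero).eventually hd.ode] with z hz
  rw [hderiv, deriv.fun_neg, hderiv, neg_neg, hz]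

theorem IsD.conj_apply_conj (hd : IsD κ d) (z : ℂ) : conj (d (conj z)) = d z :=
  congrFun (IsD.unique (isD_iff.2
    ⟨fun z _ => meromorphicNFAt_conj_comp_conj (hd.meromorphic (Set.mem_univ (conj z))),
      hd.isGerm.conj_comp_conj⟩) hd) z

theorem IsD.apply_neg (hd : IsD κ d) (z : ℂ) : d (-z) = d z :=
  congrFun (IsD.unique (isD_iff.2
    ⟨fun z _ => (hd.meromorphic (Set.mem_univ (-z))).comp_analyticAt (by fun_prop),
      hd.isGerm.comp_neg⟩) hd) z

theorem IsD.ofReal_re (hd : IsD κ d) (x : ℝ) : ((d x).re : ℂ) = d x :=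
  conj_eq_iff_re.1 (by simpa using hd.conj_apply_conj x)

theorem IsD.ofReal_re_deriv (hd : IsD κ d) (x : ℝ) : ((deriv d x).re : ℂ) = deriv d x := by
  have h := congrFun (deriv_conj_comp_conj d) x
  rw [funext hd.conj_apply_conj, conj_ofReal] at h
  exact conj_eq_iff_re.1 h.symm

theorem IsD.ode (hd : IsD κ d) {z : ℂ} (hz : AnalyticAt ℂ d z) :
    deriv (deriv d) =ᶠ[𝓝 z] fun w => 1 - κ ^ 2 + 2 * d w - 3 * d w ^ 2 := by
  have hd' := hd.meromorphic.meromorphicOn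
  exact eventuallyEq_nhds_of_meromorphicOn hd'.deriv.deriv
    (((MeromorphicOn.const (1 - (κ : ℂ) ^ 2)).fun_add ((MeromorphicOn.const 2).fun_mul hd')).fun_sub
      ((MeromorphicOn.const 3).fun_mul (hd'.fun_pow 2)))
    isPreconnected_univ (Set.mem_univ 0) (Set.mem_univ z) hz.deriv.deriv (by fun_prop)
    (hd.isGerm.ode.filter_mono nhdsWithin_le_nhds)

theorem IsD.energy (hd : IsD κ d) {z : ℂ} (hz : AnalyticAt ℂ d z) :
    deriv d z ^ 2 = 2 * (1 - d z) * (d z ^ 2 - (1 - κ ^ 2)) := by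
  have hd' := hd.meromorphic.meromorphicOn
  exact (eventuallyEq_nhds_of_meromorphicOn (hd'.deriv.fun_pow 2)
    (((MeromorphicOn.const 2).fun_mul ((MeromorphicOn.const 1).fun_sub hd')).fun_mul
      ((hd'.fun_pow 2).fun_sub (MeromorphicOn.const (1 - (κ : ℂ) ^ 2))))
    isPreconnected_univ (Set.mem_univ 0) (Set.mem_univ z) (hz.deriv.fun_pow 2) (by fun_prop)
    (hd.isGerm.energy.filter_mono nhdsWithin_le_nhds)).eq_of_nhds

theorem IsD.re_energy {lam : ℝ} (h : κ ^ 2 + lam ^ 2 = 1) (hd : IsD κ d) {x : ℝ}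
    (hx : AnalyticAt ℂ d x) :
    (deriv d x).re ^ 2 = 2 * (1 - (d x).re) * ((d x).re ^ 2 - lam ^ 2) := by
  have henergy := hd.energy hx
  rw [← hd.ofReal_re, ← hd.ofReal_re_deriv] at henergy
  rw [eq_sub_of_add_eq' h]
  exact_mod_cast henergy

end Symmetry

section RealAxis

theorem analyticAt_of_frequently_norm_le {𝕜 E : Type*} [NontriviallyNormedField 𝕜]
    [NormedAddCommGroup E] [NormedSpace 𝕜 E] {f : 𝕜 → E} {z : 𝕜} {C : ℝ}
    (hf : MeromorphicNFAt f z) (h : ∃ᶠ w in 𝓝[≠] z, ‖f w‖ ≤ C) : AnalyticAt 𝕜 f z := by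
  rw [← hf.meromorphicOrderAt_nonneg_iff_analyticAt]
  by_contra hneg
  have hpole := tendsto_norm_atTop_iff_cobounded.2
    (tendsto_cobounded_of_meromorphicOrderAt_neg (not_le.1 hneg))
  exact h ((hpole.eventually_gt_atTop C).mono fun w hw => not_le.2 hw)

theorem continuousAt_re_comp_ofReal {f : ℂ → ℂ} {x : ℝ} (hf : ContinuousAt f x) :
    ContinuousAt (fun y : ℝ => (f y).re) x :=
  continuous_re.continuousAt.comp
    (ContinuousAt.comp (f := fun y : ℝ => (y : ℂ)) hf continuous_ofReal.continuousAt)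

theorem mem_Icc_of_sq_eq {u v lam : ℝ} (hlam : lam ≤ 1) (hu : -lam < u)
    (h : v ^ 2 = 2 * (1 - u) * (u ^ 2 - lam ^ 2)) : u ∈ Set.Icc lam 1 := by
  have hfac : 0 ≤ (1 - u) * (u - lam) * (u + lam) := by linarith [sq_nonneg v]
  have hprod := nonneg_of_mul_nonneg_left hfac (by linarith)
  constructor <;> by_contra hlt <;> nlinarith

variable {κ lam : ℝ} {d : ℂ → ℂ}

theorem IsD.isOpen_setOf_analyticAt_re_mem_Icc (h : κ ^ 2 + lam ^ 2 = 1) (hlam : 0 < lam)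
    (hd : IsD κ d) : IsOpen {x : ℝ | AnalyticAt ℂ d x ∧ (d x).re ∈ Set.Icc lam 1} := by
  have hlam1 : lam ≤ 1 := by nlinarith
  refine isOpen_iff_mem_nhds.2 fun x hx => ?_
  have hcont := continuousAt_re_comp_ofReal hx.1.continuousAt
  filter_upwards [(continuous_ofReal.tendsto x).eventually hx.1.eventually_analyticAt,
    hcont.eventually_const_lt (by linarith [hx.2.1] : -lam < (d x).re)] with y hy hlt
  exact ⟨hy, mem_Icc_of_sq_eq hlam1 hlt (hd.re_energy h hy)⟩

theorem IsD.isClosed_setOf_analyticAt_re_mem_Icc (hlam : 0 < lam) (hd : IsD κ d) :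
    IsClosed {x : ℝ | AnalyticAt ℂ d x ∧ (d x).re ∈ Set.Icc lam 1} := by
  refine isClosed_iff_frequently.2 fun x hx => ?_
  by_cases hxmem : AnalyticAt ℂ d x ∧ (d x).re ∈ Set.Icc lam 1
  · exact hxmem
  have hpunct : ∃ᶠ y : ℝ in 𝓝[≠] x, AnalyticAt ℂ d (y : ℂ) ∧ (d y).re ∈ Set.Icc lam 1 :=
    frequently_nhdsWithin_iff.2 (hx.mono fun y hy => ⟨hy, fun hyx => hxmem (hyx ▸ hy)⟩)
  have htend : Tendsto (fun y : ℝ => (y : ℂ)) (𝓝[≠] x) (𝓝[≠] (x : ℂ)) :=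
    continuous_ofReal.continuousWithinAt.tendsto_nhdsWithin fun y hy => by simpa using hy
  have han : AnalyticAt ℂ d x := by
    refine analyticAt_of_frequently_norm_le (C := 1) (hd.meromorphic (Set.mem_univ _))
      (htend.frequently (hpunct.mono fun y hy => ?_))
    rw [← hd.ofReal_re, norm_real, Real.norm_of_nonneg (hlam.le.trans hy.2.1)]
    exact hy.2.2
  have hcont := continuousAt_re_comp_ofReal han.continuousAt
  exact ⟨han, isClosed_Icc.mem_of_frequently_of_tendsto (hx.mono fun y hy => hy.2) hcont⟩

theorem IsD.analyticAt_and_re_mem_Icc (h : κ ^ 2 + lam ^ 2 = 1) (hlam : 0 < lam) (hd : IsD κ d)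
    (x : ℝ) : AnalyticAt ℂ d x ∧ (d x).re ∈ Set.Icc lam 1 := by
  have hclopen : IsClopen {x : ℝ | AnalyticAt ℂ d x ∧ (d x).re ∈ Set.Icc lam 1} :=
    ⟨hd.isClosed_setOf_analyticAt_re_mem_Icc hlam, hd.isOpen_setOf_analyticAt_re_mem_Icc h hlam⟩
  have hzero : AnalyticAt ℂ d (0 : ℝ) ∧ (d (0 : ℝ)).re ∈ Set.Icc lam 1 := by
    rw [ofReal_zero, hd.isGerm.map_zero, one_re]
    exact ⟨hd.isGerm.analyticAt, by nlinarith, le_rfl⟩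
  exact Set.eq_univ_iff_forall.1 (hclopen.eq_univ ⟨0, hzero⟩) x

end RealAxis

section Energy

variable {u v : ℝ → ℝ}

theorem exists_nonpos_of_hasDerivAt_le_neg {a c : ℝ} (hc : 0 < c)
    (hu : ∀ x, a ≤ x → HasDerivAt u (v x) x) (hv : ∀ x, a ≤ x → v x ≤ -c) :
    ∃ x, a ≤ x ∧ u x ≤ 0 := by
  have hle : a ≤ a + |u a| / c := le_add_of_nonneg_right (by positivity)
  have hdecay := (convex_Ici a).image_sub_le_mul_sub_of_deriv_le (C := -c)
    (fun x hx => (hu x hx).continuousAt.continuousWithinAt)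
    (fun x hx => (hu x (interior_subset hx)).differentiableAt.differentiableWithinAt)
    (fun x hx => (hu x (interior_subset hx)).deriv ▸ hv x (interior_subset hx))
    a Set.self_mem_Ici _ hle hle
  rw [add_sub_cancel_left, neg_mul, mul_div_cancel₀ _ hc.ne'] at hdecay
  exact ⟨_, hle, by linarith [le_abs_self (u a)]⟩

theorem neg_of_hasDerivAt_ne_zero {D : Set ℝ} {a b : ℝ} (hD : Convex ℝ D)
    (hu : ∀ x, HasDerivAt u (v x) x) (hne : ∀ x ∈ interior D, v x ≠ 0) (ha : a ∈ D) (hb : b ∈ D)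
    (hab : a < b) (hle : u b ≤ u a) : ∀ x ∈ interior D, v x < 0 := by
  refine (hasDerivWithinAt_forall_lt_or_forall_gt_of_forall_ne hD.interior
    (fun x _ => (hu x).hasDerivWithinAt) hne).resolve_right fun hpos => hle.not_gt ?_
  exact strictMonoOn_of_hasDerivWithinAt_pos hD
    (fun x _ => (hu x).continuousAt.continuousWithinAt) (fun x _ => (hu x).hasDerivWithinAt) hpos
    ha hb hab

theorem exists_first_pos_zero (hv : Continuous v) (hzero : ∃ x > 0, v x = 0)
    (hne : ∀ᶠ x in 𝓝[>] 0, v x ≠ 0) : ∃ K > 0, v K = 0 ∧ ∀ x ∈ Set.Ioo 0 K, v x ≠ 0 := by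
  obtain ⟨b, hb, hvb⟩ := hzero
  obtain ⟨ε, hε, hvε⟩ := mem_nhdsGT_iff_exists_Ioo_subset.1 hne
  have hεle {x : ℝ} (hx : 0 < x) (hvx : v x = 0) : ε ≤ x :=
    not_lt.1 fun hlt => hvε ⟨hx, hlt⟩ hvx
  have hcompact : IsCompact (Set.Icc ε b ∩ v ⁻¹' {0}) :=
    isCompact_Icc.inter_right (isClosed_singleton.preimage hv)
  obtain ⟨K, ⟨hK, hvK⟩, hleast⟩ := hcompact.exists_isLeast ⟨b, ⟨hεle hb hvb, le_rfl⟩, hvb⟩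
  refine ⟨K, lt_of_lt_of_le hε hK.1, hvK, fun x hx hvx => hx.2.not_ge ?_⟩
  exact hleast ⟨⟨hεle hx.1 hvx, hx.2.le.trans hK.2⟩, hvx⟩

theorem eq_neg_sqrt_mul_sqrt_of_sq_eq {u v lam : ℝ} (hu : u ≤ 1) (hv : v ≤ 0)
    (h : v ^ 2 = 2 * (1 - u) * (u ^ 2 - lam ^ 2)) :
    v = -(√(2 * (1 - u)) * √(u ^ 2 - lam ^ 2)) := by
  rw [← Real.sqrt_mul (by linarith), ← h, Real.sqrt_sq_eq_abs, abs_of_nonpos hv, neg_neg]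

variable {lam : ℝ}

theorem exists_pos_eq_zero_of_energy (hlam : 0 < lam) (hu : ∀ x, HasDerivAt u (v x) x)
    (hmem : ∀ x, u x ∈ Set.Icc lam 1)
    (henergy : ∀ x, v x ^ 2 = 2 * (1 - u x) * (u x ^ 2 - lam ^ 2)) (hu0 : u 0 = 1) :
    ∃ x > 0, v x = 0 := by
  by_contra! hne
  have hneg : ∀ x ∈ interior (Set.Ici 0), v x < 0 :=
    neg_of_hasDerivAt_ne_zero (convex_Ici 0) hu (by simpa using hne) (a := 0) (b := 1)
      (by simp) (by simp) one_pos (hu0 ▸ (hmem 1).2)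
  have hanti : StrictAntiOn u (Set.Ici 0) :=
    strictAntiOn_of_hasDerivWithinAt_neg (convex_Ici 0)
      (fun x _ => (hu x).continuousAt.continuousWithinAt) (fun x _ => (hu x).hasDerivWithinAt) hneg
  rw [interior_Ici] at hneg
  have hpos {x : ℝ} (hx : 0 < x) : 0 < u x ^ 2 - lam ^ 2 :=
    pos_of_mul_pos_right ((henergy x).symm ▸ sq_pos_of_neg (hneg x hx)) (by linarith [(hmem x).2])
  -- The square root of `u² - λ²` would decrease at least at a fixed linear rate on `[1, ∞)`.
  have hsqrt {x : ℝ} (hx : 0 < x) :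
      HasDerivAt (fun x => √(u x ^ 2 - lam ^ 2)) (-(u x * √(2 * (1 - u x)))) x := by
    refine ((((hu x).fun_pow 2).sub_const (lam ^ 2)).sqrt (hpos hx).ne').congr_deriv ?_
    rw [eq_neg_sqrt_mul_sqrt_of_sq_eq (hmem x).2 (hneg x hx).le (henergy x)]
    have := Real.sqrt_pos.2 (hpos hx)
    field_simp
    push_cast
    ring
  have hu1 : u 1 < 1 :=
    (hanti (Set.mem_Ici.2 le_rfl) (Set.mem_Ici.2 zero_le_one) one_pos).trans_eq hu0
  have hrate : 0 < lam * √(2 * (1 - u 1)) := mul_pos hlam (Real.sqrt_pos.2 (by linarith))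
  obtain ⟨x, hx, hle⟩ := exists_nonpos_of_hasDerivAt_le_neg hrate
    (fun x hx => hsqrt (one_pos.trans_le hx)) fun x hx => by
      have hux : u x ≤ u 1 := hanti.antitoneOn (by simp) (one_pos.le.trans hx) hx
      exact neg_le_neg (mul_le_mul (hmem x).1 (Real.sqrt_le_sqrt (by linarith))
        (Real.sqrt_nonneg _) (hlam.le.trans (hmem x).1))
  exact hle.not_gt (Real.sqrt_pos.2 (hpos (one_pos.trans_le hx)))

theorem hasDerivAt_arccos_comp_of_energy {x : ℝ} (hu : HasDerivAt u (v x) x)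
    (hmem : u x ∈ Set.Ioo lam 1) (hlam : 0 < lam) (hv : v x ≤ 0)
    (henergy : v x ^ 2 = 2 * (1 - u x) * (u x ^ 2 - lam ^ 2)) :
    HasDerivAt (fun x => Real.arccos (u x))
      (√(Real.cos (Real.arccos (u x)) ^ 2 - lam ^ 2) / Real.cos (Real.arccos (u x) / 2)) x := by
  have hcos : Real.cos (Real.arccos (u x) / 2) = √((1 + u x) / 2) := by
    rw [Real.cos_half (by linarith [Real.arccos_nonneg (u x), Real.pi_pos]) (Real.arccos_le_pi _),
      Real.cos_arccos (by linarith [hmem.1]) hmem.2.le]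
  have hsqrt : √(1 - u x ^ 2) = √(2 * (1 - u x)) * √((1 + u x) / 2) := by
    rw [← Real.sqrt_mul (by linarith [hmem.2])]
    ring_nf
  have h₁ : 0 < √(2 * (1 - u x)) := Real.sqrt_pos.2 (by linarith [hmem.2])
  have h₂ : 0 < √((1 + u x) / 2) := Real.sqrt_pos.2 (by linarith [hmem.1])
  refine ((Real.hasDerivAt_arccos (by linarith [hmem.1]) hmem.2.ne).comp x hu).congr_deriv ?_
  rw [Real.cos_arccos (by linarith [hmem.1]) hmem.2.le, hcos, hsqrt,
    eq_neg_sqrt_mul_sqrt_of_sq_eq hmem.2.le hv henergy]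
  field_simp

theorem integral_eq_of_deriv_mul_eq_one {θ θ' g : ℝ → ℝ} {a b : ℝ} (hab : a ≤ b)
    (hθ : ContinuousOn θ (Set.Icc a b)) (hderiv : ∀ x ∈ Set.Ioo a b, HasDerivAt θ (θ' x) x)
    (hnonneg : ∀ x ∈ Set.Ioo a b, 0 ≤ θ' x) (hone : ∀ x ∈ Set.Ioo a b, θ' x * g (θ x) = 1) :
    ∫ t in θ a..θ b, g t = b - a := by
  rw [← intervalIntegral.integral_deriv_smul_comp_of_deriv_nonneg (by rwa [Set.uIcc_of_le hab])
    (by rwa [min_eq_left hab, max_eq_right hab]) (by rwa [min_eq_left hab, max_eq_right hab]),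
    intervalIntegral.integral_of_le hab, MeasureTheory.integral_Ioc_eq_integral_Ioo,
    MeasureTheory.setIntegral_congr_fun (f := fun x => θ' x • (g ∘ θ) x) (g := fun _ => 1)
      measurableSet_Ioo hone]
  simp [hab]

theorem I_eq_of_energy {β K : ℝ} (hβ : β ∈ Set.Ioo 0 (Real.pi / 2)) (hK : 0 ≤ K)
    (hu : ∀ x, HasDerivAt u (v x) x) (hmem : ∀ x ∈ Set.Ioo 0 K, u x ∈ Set.Ioo (Real.cos β) 1)
    (hv : ∀ x ∈ Set.Ioo 0 K, v x ≤ 0)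
    (henergy : ∀ x, v x ^ 2 = 2 * (1 - u x) * (u x ^ 2 - Real.cos β ^ 2))
    (hu0 : u 0 = 1) (huK : u K = Real.cos β) : I β = K := by
  have hβpos : 0 < Real.cos β := Real.cos_pos_of_mem_Ioo ⟨by linarith [hβ.1, hβ.2], hβ.2⟩
  have hhalf (x : ℝ) : 0 ≤ Real.cos (Real.arccos (u x) / 2) := Real.cos_nonneg_of_mem_Icc
    ⟨by linarith [Real.arccos_nonneg (u x), Real.pi_pos], by linarith [Real.arccos_le_pi (u x)]⟩
  have hintegral := integral_eq_of_deriv_mul_eq_one (θ := fun x => Real.arccos (u x))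
    (g := fun t => Real.cos (t / 2) / √(Real.cos t ^ 2 - Real.cos β ^ 2)) hK
    (fun x _ => (Real.continuous_arccos.continuousAt.comp (hu x).continuousAt).continuousWithinAt)
    (fun x hx => hasDerivAt_arccos_comp_of_energy (hu x) (hmem x hx) hβpos (hv x hx) (henergy x))
    (fun x _ => div_nonneg (Real.sqrt_nonneg _) (hhalf x)) fun x hx => ?_
  · rwa [hu0, huK, Real.arccos_one, Real.arccos_cos hβ.1.le (by linarith [hβ.2, Real.pi_pos]),
      sub_zero] at hintegral
  obtain ⟨hlt, hlt1⟩ := hmem x hx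
  have hne : Real.cos (Real.arccos (u x) / 2) ≠ 0 := by
    rw [Real.cos_half (by linarith [Real.arccos_nonneg (u x), Real.pi_pos]) (Real.arccos_le_pi _),
      Real.cos_arccos (by linarith) hlt1.le]
    exact (Real.sqrt_pos.2 (by linarith)).ne'
  have hne' : √(Real.cos (Real.arccos (u x)) ^ 2 - Real.cos β ^ 2) ≠ 0 := by
    rw [Real.cos_arccos (by linarith) hlt1.le]
    exact (Real.sqrt_pos.2 (by nlinarith)).ne'
  rw [div_mul_div_comm, mul_comm, div_self (mul_ne_zero hne hne')]

end Energy

variable {κ β : ℝ} {d : ℂ → ℂ}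

theorem IsD.hasDerivAt_re_deriv_zero (hd : IsD κ d) :
    HasDerivAt (fun x : ℝ => (deriv d x).re) (-κ ^ 2) 0 := by
  have hderiv := hd.isGerm.analyticAt.deriv.differentiableAt.hasDerivAt
  rw [hd.isGerm.ode.self_of_nhds, hd.isGerm.map_zero, ← ofReal_zero] at hderiv
  refine hderiv.real_of_complex.congr_deriv ?_
  rw [show 1 - (κ : ℂ) ^ 2 + 2 * 1 - 3 * 1 ^ 2 = ((-κ ^ 2 : ℝ) : ℂ) by push_cast; ring,
    Complex.ofReal_re]

theorem IsD.I_turning_point (hβ : β ∈ Set.Ioo 0 (Real.pi / 2))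
    (h : κ ^ 2 + Real.cos β ^ 2 = 1) (hκ : κ ≠ 0) (hd : IsD κ d) :
    0 < I β ∧ deriv d (I β) = 0 ∧ d (I β) = Real.cos β ∧
      StrictAntiOn (fun x : ℝ => (d x).re) (Set.Icc 0 (I β)) := by
  have hβpos : 0 < Real.cos β := Real.cos_pos_of_mem_Ioo ⟨by linarith [hβ.1, hβ.2], hβ.2⟩
  have haxis := hd.analyticAt_and_re_mem_Icc h hβpos
  have hu (x : ℝ) : HasDerivAt (fun x : ℝ => (d x).re) (deriv d x).re x :=
    (haxis x).1.differentiableAt.hasDerivAt.real_of_complex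
  have hu0 : (d (0 : ℝ)).re = 1 := by simp [hd.isGerm.map_zero]
  have henergy (x : ℝ) := hd.re_energy h (haxis x).1
  have hv : Continuous fun x : ℝ => (deriv d x).re := continuous_iff_continuousAt.2 fun x =>
    continuousAt_re_comp_ofReal (haxis x).1.deriv.continuousAt
  obtain ⟨K, hK, hvK, hne⟩ := exists_first_pos_zero hv
    (exists_pos_eq_zero_of_energy hβpos hu (fun x => (haxis x).2) henergy hu0)
    ((hd.hasDerivAt_re_deriv_zero.eventually_ne (by simpa using hκ)).filter_mono
      (nhdsWithin_mono 0 fun x hx => hx.ne'))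
  have hneg : ∀ x ∈ interior (Set.Icc 0 K), (deriv d x).re < 0 :=
    neg_of_hasDerivAt_ne_zero (convex_Icc 0 K) hu (by rwa [interior_Icc])
      (Set.left_mem_Icc.2 hK.le) (Set.right_mem_Icc.2 hK.le) hK (hu0 ▸ (haxis K).2.2)
  have hanti : StrictAntiOn (fun x : ℝ => (d x).re) (Set.Icc 0 K) :=
    strictAntiOn_of_hasDerivWithinAt_neg (convex_Icc 0 K)
      (fun x _ => (hu x).continuousAt.continuousWithinAt) (fun x _ => (hu x).hasDerivWithinAt) hneg
  rw [interior_Icc] at hneg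
  have huK1 : (d K).re < 1 :=
    (hanti (Set.left_mem_Icc.2 hK.le) (Set.right_mem_Icc.2 hK.le) hK).trans_eq hu0
  have huK : (d K).re = Real.cos β := by
    have hprod := henergy K
    rw [hvK, zero_pow two_ne_zero, zero_eq_mul, sq_sub_sq] at hprod
    nlinarith [(haxis K).2.1, hprod.resolve_left (by linarith)]
  have hmem (x : ℝ) (hx : x ∈ Set.Ioo 0 K) : (d x).re ∈ Set.Ioo (Real.cos β) 1 := by
    rw [← huK, ← hu0]
    exact ⟨hanti (Set.Ioo_subset_Icc_self hx) (Set.right_mem_Icc.2 hK.le) hx.2,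
      hanti (Set.left_mem_Icc.2 hK.le) (Set.Ioo_subset_Icc_self hx) hx.1⟩
  rw [I_eq_of_energy hβ hK.le hu hmem (fun x hx => (hneg x hx).le) henergy hu0 huK]
  exact ⟨hK, by rw [← hd.ofReal_re_deriv, hvK, ofReal_zero], by rw [← hd.ofReal_re, huK], hanti⟩

/-! ### The imaginary axis and the period lattice -/

section ImaginaryAxis

theorem periodic_of_eventuallyEq_nhdsNE {f g : ℂ → ℂ} (hf : MeromorphicNFOn f Set.univ)
    (hg : MeromorphicOn g Set.univ) {x : ℂ} (h : f =ᶠ[𝓝[≠] x] g) {ω : ℂ}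
    (hω : Function.Periodic g ω) : Function.Periodic f ω := by
  have hshift : Tendsto (fun z => z + ω) (𝓝[≠] x) (𝓝[≠] (x + ω)) :=
    (continuous_add_const ω).continuousWithinAt.tendsto_nhdsWithin fun z hz => by simpa using hz
  have hω' := hshift.eventually (eventuallyEq_nhdsNE_of_meromorphicOn hf.meromorphicOn hg
    isPreconnected_univ (Set.mem_univ x) (Set.mem_univ (x + ω)) h)
  refine congrFun (eq_of_meromorphicNFOn_univ (x := x) (f := fun z => f (z + ω))
    (fun z _ => (hf (Set.mem_univ (z + ω))).comp_analyticAt (g := fun z => z + ω)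
      (by fun_prop)) hf ?_)
  filter_upwards [h, hω'] with z hz hzω
  rw [hzω, hω z, hz]

variable {κ lam : ℝ} {d e : ℂ → ℂ}

theorem IsD.comp_reflection (hd : IsD κ d) {K : ℂ} (hK : AnalyticAt ℂ d K) (hd0 : deriv d K = 0)
    (z : ℂ) : d (2 * K - z) = d z := by
  have hmid : 2 * K - K = K := by ring
  have hderiv (g : ℂ → ℂ) : deriv (fun z => g (2 * K - z)) = fun z => -deriv g (2 * K - z) :=
    funext fun z => deriv_comp_const_sub g (2 * K) z
  have hrefl : Tendsto (fun z => 2 * K - z) (𝓝 K) (𝓝 K) :=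
    Continuous.tendsto' (by fun_prop) _ _ hmid
  have hEq : (fun z => d (2 * K - z)) =ᶠ[𝓝 K] d := by
    refine eventuallyEq_of_deriv_deriv_eq (P := fun w => 1 - (κ : ℂ) ^ 2 + 2 * w - 3 * w ^ 2)
      (AnalyticAt.fun_comp (g := d) (by rwa [hmid]) (by fun_prop)) hK (by fun_prop)
      (by rw [hmid]) (by simp [hderiv, hmid, hd0]) ?_ (hd.ode hK)
    filter_upwards [hrefl.eventually (hd.ode hK)] with z hz
    rw [hderiv, deriv.fun_neg, hderiv, neg_neg, hz]
  exact congrFun (eq_of_meromorphicNFOn_univ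
    (fun z _ => (hd.meromorphic (Set.mem_univ (2 * K - z))).comp_analyticAt (by fun_prop))
    hd.meromorphic (hEq.filter_mono nhdsWithin_le_nhds)) z

theorem IsD.periodic_two_mul (hd : IsD κ d) {K : ℂ} (hK : AnalyticAt ℂ d K)
    (hd0 : deriv d K = 0) : Function.Periodic d (2 * K) := fun z => by
  rw [← hd.comp_reflection hK hd0, add_comm, sub_add_cancel_left, hd.apply_neg]

theorem IsD.periodic_mul_sqrt_two_mul_I (h : κ ^ 2 + lam ^ 2 = 1) (hlam : lam ≠ 0) (hd : IsD κ d)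
    (he : IsD lam e) {ω : ℂ} (hω : Function.Periodic e ω) :
    Function.Periodic d (ω * (√2 * Complex.I)) := by
  have hgerm := he.isGerm.isogeny_comp_mul h hlam two_mul_inv_sqrt_two_mul_I_sq
  refine periodic_of_eventuallyEq_nhdsNE hd.meromorphic (fun v _ => meromorphicAt_isogeny_comp κ
    (f := fun v => e ((√2 * Complex.I : ℂ)⁻¹ * v))
    ((he.meromorphic (Set.mem_univ _)).meromorphicAt.comp_analyticAt (by fun_prop)))
    ((hd.isGerm.unique hgerm).filter_mono nhdsWithin_le_nhds) fun v => ?_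
  have hne : (√2 * Complex.I : ℂ) ≠ 0 := by simp
  beta_reduce
  rw [mul_add, mul_left_comm, inv_mul_cancel₀ hne, mul_one, hω]

theorem IsD.sub_one_mul_sq_sub_sq (h : κ ^ 2 + lam ^ 2 = 1) (hlam : lam ≠ 0) (hd : IsD κ d)
    (he : IsD lam e) {u : ℂ} (hdu : AnalyticAt ℂ d (u * (√2 * Complex.I)))
    (heu : AnalyticAt ℂ e u) :
    (d (u * (√2 * Complex.I)) - 1) * (e u ^ 2 - κ ^ 2) = 2 * κ ^ 2 * (1 - e u) := by
  have hne : (√2 * Complex.I : ℂ) ≠ 0 := by simp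
  have hmul : Tendsto (fun u : ℂ => u * (√2 * Complex.I)) (𝓝 0) (𝓝 0) :=
    Continuous.tendsto' (by fun_prop) _ _ (by simp)
  have hd' : MeromorphicOn (fun u => d (u * (√2 * Complex.I))) Set.univ := fun u _ =>
    (hd.meromorphic (Set.mem_univ _)).meromorphicAt.comp_analyticAt (by fun_prop)
  have he' := he.meromorphic.meromorphicOn
  have hdu' : AnalyticAt ℂ (fun u => d (u * (√2 * Complex.I))) u :=
    AnalyticAt.fun_comp (g := d) hdu (by fun_prop)
  refine (eventuallyEq_nhds_of_meromorphicOn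
    ((hd'.fun_sub (MeromorphicOn.const 1)).fun_mul
      ((he'.fun_pow 2).fun_sub (MeromorphicOn.const ((κ : ℂ) ^ 2))))
    ((MeromorphicOn.const (2 * (κ : ℂ) ^ 2)).fun_mul ((MeromorphicOn.const 1).fun_sub he'))
    isPreconnected_univ (Set.mem_univ 0) (Set.mem_univ u)
    ((hdu'.fun_sub analyticAt_const).fun_mul (by fun_prop)) (by fun_prop)
    (EventuallyEq.filter_mono ?_ nhdsWithin_le_nhds)).eq_of_nhds
  have hgerm := he.isGerm.isogeny_comp_mul h hlam two_mul_inv_sqrt_two_mul_I_sq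
  filter_upwards [hmul.eventually (hd.isGerm.unique hgerm),
    he.isGerm.eventually_sq_sub_sq_ne_zero h hlam] with w hw hew
  rw [hw, mul_left_comm, inv_mul_cancel₀ hne, mul_one, isogeny, add_sub_cancel_left,
    div_mul_cancel₀ _ hew]

theorem IsD.eq_zero_of_not_analyticAt (hd : IsD κ d) {z : ℂ} (hz : ¬AnalyticAt ℂ d z) : d z = 0 :=
  ((meromorphicNFAt_iff_analyticAt_or.1 (hd.meromorphic (Set.mem_univ z))).resolve_left hz).2.2

theorem IsD.apply_mul_sqrt_two_mul_I_ne_one (h : κ ^ 2 + lam ^ 2 = 1) (hκ : κ ≠ 0) (hlam : lam ≠ 0)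
    (hd : IsD κ d) (he : IsD lam e) {u : ℂ} (hu : AnalyticAt ℂ e u) (hu1 : e u ≠ 1) :
    d (u * (√2 * Complex.I)) ≠ 1 := by
  intro hd1
  have hdu : AnalyticAt ℂ d (u * (√2 * Complex.I)) := by
    by_contra hpole
    exact zero_ne_one ((hd.eq_zero_of_not_analyticAt hpole).symm.trans hd1)
  have hprod := hd.sub_one_mul_sq_sub_sq h hlam he hdu hu
  rw [hd1, sub_self, zero_mul] at hprod
  exact mul_ne_zero (by simpa using hκ) (sub_ne_zero.2 hu1.symm) hprod.symm

/-- The point is in fact a pole of `d`, where the normal form takes the value `0`. -/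
theorem IsD.apply_mul_sqrt_two_mul_I_eq_zero (h : κ ^ 2 + lam ^ 2 = 1) (hκ : κ ≠ 0)
    (hlam : lam ≠ 0) (hd : IsD κ d) (he : IsD lam e) {u : ℂ} (hu : AnalyticAt ℂ e u)
    (huκ : e u ^ 2 = κ ^ 2) : d (u * (√2 * Complex.I)) = 0 := by
  refine hd.eq_zero_of_not_analyticAt fun hdu => ?_
  have hprod := hd.sub_one_mul_sq_sub_sq h hlam he hdu hu
  rw [huκ, sub_self, mul_zero] at hprod
  have hu1 := (mul_eq_zero.1 hprod.symm).resolve_left (by simpa using hκ)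
  rw [← sub_eq_zero.1 hu1, one_pow, ← ofReal_pow, ← ofReal_one, ofReal_inj] at huκ
  exact hlam (pow_eq_zero_iff two_ne_zero |>.1 (by linarith))

end ImaginaryAxis

section Periods

variable {K K' : ℝ} {ω : ℂ}

theorem exists_int_of_periodic_ofReal_mul {X : Type*} {d : ℂ → X} {e : ℂ} (hK : 0 < K)
    (heven : d.Even) (hper : Function.Periodic d (2 * K * e))
    (hne : ∀ x ∈ Set.Ioc 0 K, d (x * e) ≠ d 0) {x : ℝ} (hx : Function.Periodic d (x * e)) :
    ∃ m : ℤ, x = m * (2 * K) := by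
  have h2K : 0 < 2 * K := by positivity
  set m := round (x / (2 * K))
  refine ⟨m, sub_eq_zero.1 ?_⟩
  have hrem : |x - m * (2 * K)| ≤ K := by
    rw [show x - m * (2 * K) = (x / (2 * K) - m) * (2 * K) by field_simp, abs_mul, abs_of_pos h2K]
    linarith [mul_le_mul_of_nonneg_right (abs_sub_round (x / (2 * K))) h2K.le]
  have hdrem : d ((x - m * (2 * K) : ℝ) * e) = d 0 := by
    have hperiod := hx.sub_period (hper.int_mul m) 0
    rw [zero_add] at hperiod
    rw [← hperiod]
    congr 1
    push_cast
    ring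
  have habs : d ((|x - m * (2 * K)| : ℝ) * e) = d 0 := by
    rcases abs_choice (x - m * (2 * K)) with h | h
    · rw [h, hdrem]
    · rw [h, ofReal_neg, neg_mul, heven, hdrem]
  by_contra hrem0
  exact hne _ ⟨abs_pos.2 hrem0, hrem⟩ habs

theorem exists_int_of_periodic {d : ℂ → ℂ} (hK : 0 < K) (hK' : 0 < K') (heven : d.Even)
    (hconj : ∀ z, conj (d (conj z)) = d z) (hper : Function.Periodic d (2 * K))
    (hper' : Function.Periodic d (2 * K' * Complex.I)) (hne : ∀ x ∈ Set.Ioc 0 K, d x ≠ d 0)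
    (hne' : ∀ x ∈ Set.Ioc 0 K', d (x * Complex.I) ≠ d 0) (hω : Function.Periodic d ω) :
    ∃ m n : ℤ, ω = m * K + n * (K' * Complex.I) := by
  have hωconj : Function.Periodic d (conj ω) := fun z => by
    rw [← hconj, map_add, conj_conj, hω, hconj]
  have hre := hω.add_period hωconj
  have him := hω.sub_period hωconj
  rw [add_conj, ← mul_one ((2 * ω.re : ℝ) : ℂ)] at hre
  rw [sub_conj] at him
  obtain ⟨m, hm⟩ := exists_int_of_periodic_ofReal_mul hK heven (by simpa using hper)
    (by simpa using hne) hre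
  obtain ⟨n, hn⟩ := exists_int_of_periodic_ofReal_mul hK' heven hper' hne' him
  refine ⟨m, n, Complex.ext ?_ ?_⟩
  · simpa using by linarith
  · simpa using by linarith

theorem isHalfPeriods_of {d : ℂ → ℂ} (hK : 0 < K) (hK' : 0 < K') (heven : d.Even)
    (hconj : ∀ z, conj (d (conj z)) = d z) (hper : Function.Periodic d (2 * K))
    (hper' : Function.Periodic d (2 * K' * Complex.I)) (hne : ∀ x ∈ Set.Ioc 0 K, d x ≠ d 0)
    (hne' : ∀ x ∈ Set.Ioc 0 K', d (x * Complex.I) ≠ d 0) (hmix : d (K' * Complex.I) ≠ d K) :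
    IsHalfPeriods d K K' := by
  have hlattice (a b : ℤ) : Function.Periodic d (a * (2 * K) + b * (2 * Complex.I * K')) := by
    have hsum := (hper.int_mul a).add_period (hper'.int_mul b)
    rwa [mul_right_comm 2 (K' : ℂ)] at hsum
  refine ⟨hK, hK', fun ω => ⟨fun hω => ?_, fun ⟨a, b, h⟩ => h ▸ hlattice a b⟩⟩
  obtain ⟨m, n, rfl⟩ := exists_int_of_periodic hK hK' heven hconj hper hper' hne hne' hω
  -- Modulo the lattice only the three half periods are left to be excluded.
  have hreduce {η : ℂ} (a b : ℤ) (h : m * K + n * (K' * Complex.I) =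
      η + (a * (2 * K) + b * (2 * Complex.I * K'))) : Function.Periodic d η := by
    have hdiff := hω.sub_period (hlattice a b)
    rwa [h, add_sub_cancel_right] at hdiff
  obtain ⟨a, rfl | rfl⟩ := Int.even_or_odd' m <;> obtain ⟨b, rfl | rfl⟩ := Int.even_or_odd' n
  · exact ⟨a, b, by push_cast; ring⟩
  · have hhalf : Function.Periodic d (K' * Complex.I) := hreduce a b (by push_cast; ring)
    exact absurd hhalf.eq (hne' K' ⟨hK', le_rfl⟩)
  · have hhalf : Function.Periodic d K := hreduce a b (by push_cast; ring)
    exact absurd hhalf.eq (hne K ⟨hK, le_rfl⟩)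
  · have hhalf : Function.Periodic d (K + K' * Complex.I) := hreduce a b (by push_cast; ring)
    have hmixed := hhalf (-K)
    rw [neg_add_cancel_left, heven] at hmixed
    exact absurd hmixed hmix

theorem le_of_eq_intCast_mul {a b : ℝ} {m : ℤ} (ha : 0 < a) (hb : 0 < b) (h : a = m * b) :
    b ≤ a := by
  have hm : 0 < m := Int.cast_pos.1 (pos_of_mul_pos_left (h ▸ ha) hb.le)
  rw [h]
  exact le_mul_of_one_le_left hb.le (Int.cast_one_le_of_pos hm)

variable {d : ℂ → ℂ} {L L' : ℝ}

theorem IsHalfPeriods.le (h : IsHalfPeriods d K K') (h' : IsHalfPeriods d L L') :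
    K ≤ L ∧ K' ≤ L' := by
  obtain ⟨m, _, hm⟩ := (h.periodic_iff (2 * L)).1 ((h'.periodic_iff _).2 ⟨1, 0, by simp⟩)
  obtain ⟨_, n, hn⟩ := (h.periodic_iff (2 * Complex.I * L')).1
    ((h'.periodic_iff _).2 ⟨0, 1, by simp⟩)
  have hL : 2 * L = m * (2 * K) := by simpa using congrArg re hm
  have hL' : 2 * L' = n * (2 * K') := by simpa using congrArg im hn
  exact ⟨le_of_eq_intCast_mul h'.pos h.pos (m := m) (by linarith),
    le_of_eq_intCast_mul h'.pos' h.pos' (m := n) (by linarith)⟩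

theorem IsHalfPeriods.unique (h : IsHalfPeriods d K K') (h' : IsHalfPeriods d L L') :
    K = L ∧ K' = L' :=
  ⟨le_antisymm (h.le h').1 (h'.le h).1, le_antisymm (h.le h').2 (h'.le h).2⟩

end Periods

section HalfPeriods

variable {α β κ : ℝ} {d : ℂ → ℂ}

theorem IsD.apply_ofReal_ne_one (hβ : β ∈ Set.Ioo 0 (Real.pi / 2))
    (h : κ ^ 2 + Real.cos β ^ 2 = 1) (hκ : κ ≠ 0) (hd : IsD κ d) {x : ℝ}
    (hx : x ∈ Set.Ioc 0 (I β)) : d x ≠ 1 := fun hdx => by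
  have hlt := (hd.I_turning_point hβ h hκ).2.2.2 (Set.left_mem_Icc.2 (hx.1.le.trans hx.2))
    (Set.Ioc_subset_Icc_self hx) hx.1
  simp [hdx, hd.isGerm.map_zero] at hlt

theorem IsD.isHalfPeriods (hα : α ∈ Set.Ioo 0 (Real.pi / 2)) (hβ : β ∈ Set.Ioo 0 (Real.pi / 2))
    (h : Real.cos α ^ 2 + Real.cos β ^ 2 = 1) (hd : IsD (Real.cos α) d) :
    IsHalfPeriods d (I β) (√2 * I α) := by
  have hαpos : 0 < Real.cos α := Real.cos_pos_of_mem_Ioo ⟨by linarith [hα.1, hα.2], hα.2⟩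
  have hβpos : 0 < Real.cos β := Real.cos_pos_of_mem_Ioo ⟨by linarith [hβ.1, hβ.2], hβ.2⟩
  have hκ := hαpos.ne'
  have hlam := hβpos.ne'
  have h' : Real.cos β ^ 2 + Real.cos α ^ 2 = 1 := by rwa [add_comm]
  obtain ⟨e, he, -⟩ := existsUnique_isD h' hlam hκ
  have hda (x : ℝ) : AnalyticAt ℂ d x := (hd.analyticAt_and_re_mem_Icc h hβpos x).1
  have hea (x : ℝ) : AnalyticAt ℂ e x := (he.analyticAt_and_re_mem_Icc h' hαpos x).1
  obtain ⟨hK, hdK, hdKval, -⟩ := hd.I_turning_point hβ h hκ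
  obtain ⟨hL, heL, heLval, -⟩ := he.I_turning_point hα h' hlam
  have hrot (u : ℝ) : ((√2 * u : ℝ) : ℂ) * Complex.I = u * (√2 * Complex.I) := by
    push_cast
    ring
  refine isHalfPeriods_of hK (by positivity) hd.apply_neg hd.conj_apply_conj
    (hd.periodic_two_mul (hda _) hdK) ?_ (fun x hx => ?_) (fun x hx => ?_) ?_
  · rw [mul_assoc, hrot, ← mul_assoc]
    exact hd.periodic_mul_sqrt_two_mul_I h hlam he (he.periodic_two_mul (hea _) heL)
  · rw [hd.isGerm.map_zero]
    exact hd.apply_ofReal_ne_one hβ h hκ hx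
  · obtain ⟨u, rfl⟩ : ∃ u, √2 * u = x := ⟨x / √2, by field_simp⟩
    have hu : u ∈ Set.Ioc 0 (I α) :=
      ⟨pos_of_mul_pos_right hx.1 (by positivity), le_of_mul_le_mul_left hx.2 (by positivity)⟩
    rw [hd.isGerm.map_zero, hrot]
    exact hd.apply_mul_sqrt_two_mul_I_ne_one h hκ hlam he (hea u)
      (he.apply_ofReal_ne_one hα h' hlam hu)
  · rw [hrot, hd.apply_mul_sqrt_two_mul_I_eq_zero h hκ hlam he (hea _) (by rw [heLval]), hdKval]
    exact (ofReal_ne_zero.2 hlam).symm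

end HalfPeriods

end SignatureFour

theorem mainTheorem5 (κ lam α β : ℝ) (hκ_pos : 0 < κ) (hκ_lt : κ < 1)
    (hlam : lam = √(1 - κ ^ 2))
    (hα_pos : 0 < α) (hα_lt : α < Real.pi / 2) (hα : κ = Real.cos α)
    (hβ_pos : 0 < β) (hβ_lt : β < Real.pi / 2) (hβ : lam = Real.cos β) :
    (∃! d : ℂ → ℂ, SignatureFour.IsD κ d) ∧
    (∃! d : ℂ → ℂ, SignatureFour.IsD lam d) ∧
    ∀ dκ dlam : ℂ → ℂ, SignatureFour.IsD κ dκ → SignatureFour.IsD lam dlam →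
      (∃! p : ℝ × ℝ, SignatureFour.IsHalfPeriods dκ p.1 p.2) ∧
      (∃! p : ℝ × ℝ, SignatureFour.IsHalfPeriods dlam p.1 p.2) ∧
      ∀ Kκ Kκ' Klam Klam' : ℝ,
        SignatureFour.IsHalfPeriods dκ Kκ Kκ' → SignatureFour.IsHalfPeriods dlam Klam Klam' →
        (Kκ = SignatureFour.I β ∧ Kκ' = √2 * SignatureFour.I α) ∧
        (Kκ' = √2 * Klam ∧ Klam' = √2 * Kκ) := by
  have hα' : α ∈ Set.Ioo 0 (Real.pi / 2) := ⟨hα_pos, hα_lt⟩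
  have hβ' : β ∈ Set.Ioo 0 (Real.pi / 2) := ⟨hβ_pos, hβ_lt⟩
  have hsq : κ ^ 2 + lam ^ 2 = 1 := by rw [hlam, Real.sq_sqrt (by nlinarith), add_sub_cancel]
  have hsq' : lam ^ 2 + κ ^ 2 = 1 := by rwa [add_comm]
  have hlam_pos : 0 < lam := hβ ▸ Real.cos_pos_of_mem_Ioo ⟨by linarith, hβ_lt⟩
  refine ⟨SignatureFour.existsUnique_isD hsq hκ_pos.ne' hlam_pos.ne',
    SignatureFour.existsUnique_isD hsq' hlam_pos.ne' hκ_pos.ne', fun dκ dlam hdκ hdlam => ?_⟩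
  subst hα hβ
  have hperκ := hdκ.isHalfPeriods hα' hβ' hsq
  have hperlam := hdlam.isHalfPeriods hβ' hα' hsq'
  refine ⟨⟨(_, _), hperκ, fun p hp => Prod.ext_iff.2 (hp.unique hperκ)⟩,
    ⟨(_, _), hperlam, fun p hp => Prod.ext_iff.2 (hp.unique hperlam)⟩,
    fun Kκ Kκ' Klam Klam' hK hL => ?_⟩
  obtain ⟨rfl, rfl⟩ := hK.unique hperκ
  obtain ⟨rfl, rfl⟩ := hL.unique hperlam
  exact ⟨⟨rfl, rfl⟩, rfl, rfl⟩
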